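/- Let $G=(V,E)$ be a finite, simple, connected, undirected graph with minimum degree $\delta$, and let $s,v\in V$. Let $(w(e))_{e\in E}$ be independent exponential random variables with parameter $1$, and let $\mathsf{UFPP}(s,v):=\inf_{\mathcal P}\sum_{e\in\mathcal P}w(e)$, where the infimum is over all paths $\mathcal P$ from $s$ to $v$ in $G$ (undirected first-passage-percolation time). Consider the randomized broadcast algorithm (push algorithm) started from $s$: $I_0=\{s\}$, and in each time-step $t=1,2,\dots$ every vertex $u\in I_{t-1}$ chooses, independently of all other choices, a neighbor uniformly at random; $I_t$ consists of $I_{t-1}$ and all the vertices so chosen. Let $\mathsf{T}_{\mathsf{RBA}}(s,v):=\min\{t\in\mathbb N_0: v\in I_t\}$. Then $$\mathbf E[\mathsf{UFPP}(s,v)]\;\le\;\frac{2}{\delta}\cdot\mathbf E[\mathsf{T}_{\mathsf{RBA}}(s,v)].$$ (If $|V|=1$, then $\delta=0$ and both expectations are $0$; the right-hand side is then read as $0$.) -/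

import Mathlib

open MeasureTheory ProbabilityTheory
open scoped ENNReal

noncomputable section

namespace PushPercolation

variable {V : Type*}

/-- The total weight of the edges of a walk, each edge `e` of the graph having weight `w e`. -/
def walkWeight {G : SimpleGraph V} (w : G.edgeSet → ℝ) {s v : V} (p : G.Walk s v) : ℝ :=
  (p.edges.attach.map fun e => w ⟨e.1, p.edges_subset_edgeSet e.2⟩).sum

/-- The undirected first-passage-percolation time from `s` to `v` for the edge weights `w`:
the infimum over all paths from `s` to `v` of the total weight of the path, as an element of
`[0, ∞]` (exponential weights are almost surely positive). -/
def ufpp (G : SimpleGraph V) (w : G.edgeSet → ℝ) (s v : V) : ℝ≥0∞ :=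
  ⨅ p : G.Path s v, ENNReal.ofReal (walkWeight w p.1)

/-- The set of informed vertices at each time of the push algorithm started from `s`, where
`c t u` is the vertex to which `u`, if informed at time `t`, sends the rumor in time-step
`t + 1`. The choices of vertices that are not informed play no role. -/
def informed (c : ℕ → V → V) (s : V) : ℕ → Set V
  | 0 => {s}
  | t + 1 => informed c s t ∪ c t '' informed c s t

/-- The first time at which `v` is informed (`⊤` if this never happens). -/
def pushTime (c : ℕ → V → V) (s v : V) : ℕ∞ :=
  ⨅ (t : ℕ) (_ : v ∈ informed c s t), (t : ℕ∞)

/-- The edge weights `w` are independent exponential random variables with parameter `1`. -/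
structure IsExpWeights {Ω : Type*} [MeasurableSpace Ω] (P : Measure Ω) (G : SimpleGraph V)
    (w : G.edgeSet → Ω → ℝ) : Prop where
  hasLaw : ∀ e, HasLaw (w e) (expMeasure 1) P
  indep : iIndepFun w P

/-- The choices `c t u` of the randomized broadcast algorithm are independent (over all times and
all vertices), and each `c t u` is uniformly distributed on the neighbors of `u`. A vertex without
neighbors (this occurs in a connected graph only if it is the sole vertex) has no condition on its
law. -/
structure IsPushChoices [MeasurableSpace V] {Ω : Type*} [MeasurableSpace Ω] (P : Measure Ω)
    (G : SimpleGraph V) (c : ℕ → V → Ω → V) : Prop where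
  hasLaw : ∀ t u, (G.neighborSet u).Nonempty → HasLaw (c t u) (uniformOn (G.neighborSet u)) P
  indep : iIndepFun (fun i : ℕ × V => c i.1 i.2) P

end PushPercolation

end

/-! Both processes are compared with directed first-passage percolation. Let the dart `(u, a)` cost
the number of steps until `u` chooses `a`, with each vertex counting its own choices from the moment
it is informed. Following the rumor back from `v` gives a walk of total cost at most the push time
(`passage_localChoices_le`). Restarting the counts does not change the law of the choices, so the
mean passage time for `waitingTime` is at most the mean push time
(`lintegral_passage_waitingTime_le`). Next let the darts out of `u` carry independent exponential
weights of rate `1 / deg u`. The first of them rings after an Exp(1) time, at a uniform dart, and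
the others then start afresh (`map_resampled_eq_map_scaled`). Passage time is an infimum of linear
functions of the weights, hence concave, so replacing the ringing time by its mean `1` can only
increase the expectation. Iterating turns the exponential weights into the waiting times
(`lintegral_passage_scaled_le`). Finally, twice the minimum of the two standard exponentials on an
edge is again Exp(1). Since `deg u ≥ δ`, `δ` times the undirected time is at most twice the directed
one (`minDegree_mul_ufpp_le`). -/

noncomputable section

namespace PushPercolation

variable {V : Type*}

/-! ### Directed passage times and waiting times -/

/-- The directed first-passage time from `s` to `v` when crossing the dart `(a, b)` takes time
`x a b`. -/
def passage (G : SimpleGraph V) (s v : V) (x : V → V → ℝ≥0∞) : ℝ≥0∞ :=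
  ⨅ p : G.Path s v, (p.1.darts.map fun d => x d.fst d.snd).sum

/-- The number of steps after which `u` has chosen `v`, when `c k u` is its choice in step
`k + 1`. -/
def waitingTime (c : ℕ → V → V) (u v : V) : ℝ≥0∞ :=
  ⨅ (k : ℕ) (_ : c k u = v), ((k : ℝ≥0∞) + 1)

lemma waitingTime_le {c : ℕ → V → V} {u v : V} {k : ℕ} (h : c k u = v) :
    waitingTime c u v ≤ k + 1 :=
  iInf₂_le k h

lemma exists_of_waitingTime_lt {c : ℕ → V → V} {u v : V} {a : ℝ≥0∞}
    (h : waitingTime c u v < a) : ∃ k : ℕ, c k u = v ∧ (k : ℝ≥0∞) + 1 < a := by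
  simpa [waitingTime, iInf_lt_iff] using h

lemma passage_le_walk (G : SimpleGraph V) {s v : V} (x : V → V → ℝ≥0∞) (p : G.Walk s v) :
    passage G s v x ≤ (p.darts.map fun d => x d.fst d.snd).sum := by
  classical
  refine (iInf_le _ p.toPath).trans ?_
  exact (p.darts_bypass_sublist_darts.map _).sum_le_sum (fun _ _ => zero_le)

lemma list_map_sum_mono {α : Type*} (l : List α) {f g : α → ℝ≥0∞} (h : ∀ a ∈ l, f a ≤ g a) :
    (l.map f).sum ≤ (l.map g).sum :=
  List.sum_le_sum h

lemma passage_mono_of_adj (G : SimpleGraph V) {s v : V} {x y : V → V → ℝ≥0∞}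
    (h : ∀ a b, G.Adj a b → x a b ≤ y a b) : passage G s v x ≤ passage G s v y :=
  iInf_mono fun _ => list_map_sum_mono _ fun d _ => h _ _ d.adj

lemma passage_mono (G : SimpleGraph V) {s v : V} {x y : V → V → ℝ≥0∞} (h : x ≤ y) :
    passage G s v x ≤ passage G s v y :=
  passage_mono_of_adj G fun a b _ => h a b

lemma exists_path_of_passage_lt {G : SimpleGraph V} {s v : V} {x : V → V → ℝ≥0∞} {a : ℝ≥0∞}
    (h : passage G s v x < a) :
    ∃ p : G.Path s v, (p.1.darts.map fun d => x d.fst d.snd).sum < a :=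
  iInf_lt_iff.mp h

/-- A path of total weight below `a` uses only darts of weight below `a`, so the other darts need no
comparison. -/
lemma passage_le_passage_of_lt {G : SimpleGraph V} {s v : V} {x y : V → V → ℝ≥0∞} {a : ℝ≥0∞}
    (hx : passage G s v x < a) (h : ∀ b c, G.Adj b c → x b c < a → y b c ≤ x b c) :
    passage G s v y ≤ passage G s v x := by
  refine le_of_forall_gt fun r hr => ?_
  obtain ⟨p, hp⟩ := exists_path_of_passage_lt (lt_min hr hx)
  refine lt_of_le_of_lt (iInf_le _ p) (lt_of_le_of_lt ?_ (lt_of_lt_of_le hp (min_le_left _ _)))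
  refine list_map_sum_mono _ fun d hd => h _ _ d.adj ?_
  refine lt_of_le_of_lt ?_ (lt_of_lt_of_le hp (min_le_right _ _))
  exact List.single_le_sum (fun _ _ => zero_le) _ (List.mem_map_of_mem hd)

/-! ### Push time and choices counted from the inform times -/

/-- The first time at which `u` is informed, `0` if this never happens. -/
def informTime (c : ℕ → V → V) (s u : V) : ℕ := sInf {t | u ∈ informed c s t}

/-- The choices of every vertex counted from the time at which it is informed. -/
def localChoices (c : ℕ → V → V) (s : V) : ℕ → V → V :=
  fun k u => c (informTime c s u + k) u

lemma informTime_le {c : ℕ → V → V} {s u : V} {t : ℕ} (h : u ∈ informed c s t) :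
    informTime c s u ≤ t :=
  Nat.sInf_le h

lemma mem_informed_informTime {c : ℕ → V → V} {s u : V} {t : ℕ} (h : u ∈ informed c s t) :
    u ∈ informed c s (informTime c s u) :=
  Nat.sInf_mem (s := {t | u ∈ informed c s t}) ⟨t, h⟩

lemma exists_walk_of_informed {G : SimpleGraph V} {c : ℕ → V → V} (s : V)
    (hc : ∀ t u, G.Adj u (c t u)) (t : ℕ) : ∀ u, u ∈ informed c s t → informTime c s u = t →
      ∃ p : G.Walk s u,
        (p.darts.map fun d => waitingTime (localChoices c s) d.fst d.snd).sum ≤ t := by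
  induction t using Nat.strong_induction_on with
  | _ t ih =>
    intro u hu ht
    cases t with
    | zero =>
      obtain rfl : u = s := hu
      exact ⟨.nil, by simp⟩
    | succ m =>
      rcases hu with hu | ⟨a, ha, rfl⟩
      · have := informTime_le hu
        omega
      · have hr := informTime_le ha
        obtain ⟨p, hp⟩ := ih _ (by omega) a (mem_informed_informTime ha) rfl
        refine ⟨p.concat (hc m a), ?_⟩
        -- The choice of `a` in step `m + 1` has index `m - informTime c s a` among its local
        -- choices, so the costs telescope along the walk.
        have h : waitingTime (localChoices c s) a (c m a) ≤
            ((m - informTime c s a : ℕ) : ℝ≥0∞) + 1 :=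
          waitingTime_le (by simp [localChoices, Nat.add_sub_cancel' hr])
        simp only [SimpleGraph.Walk.darts_concat, List.concat_eq_append, List.map_append,
          List.sum_append, List.map_cons, List.map_nil, List.sum_singleton]
        refine (add_le_add hp h).trans (le_of_eq ?_)
        rw [← add_assoc]
        exact_mod_cast congrArg (· + 1) (Nat.add_sub_cancel' hr)

lemma passage_localChoices_le {G : SimpleGraph V} {c : ℕ → V → V} (s v : V)
    (hc : ∀ t u, G.Adj u (c t u)) :
    passage G s v (waitingTime (localChoices c s)) ≤ (pushTime c s v : ℝ≥0∞) := by
  by_cases hv : ∃ t, v ∈ informed c s t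
  · obtain ⟨t, ht⟩ := hv
    obtain ⟨p, hp⟩ := exists_walk_of_informed s hc _ v (mem_informed_informTime ht) rfl
    refine (passage_le_walk G _ p).trans (hp.trans ?_)
    have : ((informTime c s v : ℕ) : ℕ∞) ≤ pushTime c s v :=
      le_iInf₂ fun r hr => by exact_mod_cast informTime_le hr
    exact_mod_cast ENat.toENNReal_le.mpr this
  · have : pushTime c s v = ⊤ := by
      simp only [not_exists] at hv
      simp [pushTime, hv]
    simp [this]

/-! ### Local choices have the law of the original choices -/

/-- The periodic choices with one period given by `f`. -/
def unroll {n : ℕ} (f : ZMod n × V → V) : ℕ → V → V := fun t u => f (t, u)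

/-- One period of the choices of every vertex counted from the time at which it is informed. -/
def rotate {n : ℕ} (s : V) (f : ZMod n × V → V) : ZMod n × V → V :=
  fun i => f ((informTime (unroll f) s i.2 : ZMod n) + i.1, i.2)

lemma unroll_rotate {n : ℕ} (s : V) (f : ZMod n × V → V) :
    unroll (rotate s f) = localChoices (unroll f) s := by
  ext k u
  simp [unroll, rotate, localChoices]

/-- Local choices determine the spread of the rumor: a vertex informed at time `T` uses its local
choice number `t - T` at time `t`, and `T` is known by then. -/
lemma informed_eq_of_rotate_eq {n : ℕ} {s : V} {f g : ZMod n × V → V}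
    (h : rotate s f = rotate s g) (t : ℕ) :
    ∀ r ≤ t, informed (unroll f) s r = informed (unroll g) s r := by
  have hl : localChoices (unroll f) s = localChoices (unroll g) s := by
    rw [← unroll_rotate, ← unroll_rotate, h]
  induction t with
  | zero =>
    intro r hr
    obtain rfl : r = 0 := by omega
    rfl
  | succ t ih =>
    intro r hr
    rcases Nat.lt_or_ge r (t + 1) with h' | h'
    · exact ih r (by omega)
    obtain rfl : r = t + 1 := by omega
    have hT : ∀ a ∈ informed (unroll f) s t, unroll f t a = unroll g t a := by
      intro a ha
      have ha' : a ∈ informed (unroll g) s t := ih t le_rfl ▸ ha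
      have h1 := informTime_le ha
      have h2 := informTime_le ha'
      have e : informTime (unroll f) s a = informTime (unroll g) s a := by
        apply le_antisymm
        · apply informTime_le
          rw [ih _ h2]
          exact mem_informed_informTime ha'
        · apply informTime_le
          rw [← ih _ h1]
          exact mem_informed_informTime ha
      have := congrFun (congrFun hl (t - informTime (unroll f) s a)) a
      simpa [localChoices, ← e, Nat.add_sub_cancel' h1] using this
    rw [informed, informed, ← ih t le_rfl, Set.image_congr hT]

/-- The inform times can be recovered from the rotated choices, so the cyclic shifts can be undone.
On a finite type this makes `rotate` a bijection. -/
lemma rotate_injective {n : ℕ} [NeZero n] (s : V) :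
    Function.Injective (rotate (n := n) s) := by
  intro f g h
  have hT : ∀ u, informTime (unroll f) s u = informTime (unroll g) s u := fun u => by
    simp only [informTime, fun t => informed_eq_of_rotate_eq h t t le_rfl]
  ext ⟨k, u⟩
  have := congrFun h (k - (informTime (unroll f) s u : ZMod n), u)
  simpa [rotate, ← hT] using this

lemma informed_congr {c c' : ℕ → V → V} {n : ℕ} (s : V) (h : ∀ k < n, c k = c' k) :
    ∀ t ≤ n, informed c s t = informed c' s t := by
  intro t
  induction t with
  | zero => intro _; rfl
  | succ t ih => intro ht; rw [informed, informed, ih (by omega), h t (by omega)]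

lemma min_pushTime_le {c c' : ℕ → V → V} {n : ℕ} (s v : V) (h : ∀ k < n, c k = c' k) :
    min (pushTime c s v : ℝ≥0∞) n ≤ pushTime c' s v := by
  have : min (pushTime c s v) n ≤ pushTime c' s v := by
    refine le_iInf₂ fun t ht => ?_
    rcases le_total t n with htn | htn
    · rw [← informed_congr s h t htn] at ht
      exact (min_le_left _ _).trans (iInf₂_le t ht)
    · exact (min_le_right _ _).trans (by exact_mod_cast htn)
  have h2 := ENat.toENNReal_le.mpr this
  simpa using h2

/-- A passage time below `n` only involves waiting times below `n`, which the first `n` choices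
determine. This permits the passage to periodic choices. -/
lemma min_passage_waitingTime_le (G : SimpleGraph V) {c c' : ℕ → V → V} {n : ℕ} (s v : V)
    (h : ∀ k < n, c k = c' k) :
    min (passage G s v (waitingTime c)) n ≤ passage G s v (waitingTime c') := by
  rcases le_or_gt (n : ℝ≥0∞) (passage G s v (waitingTime c')) with hn | hn
  · exact (min_le_right _ _).trans hn
  refine (min_le_left _ _).trans (passage_le_passage_of_lt hn fun a b _ hab => ?_)
  refine le_of_forall_gt fun r hr => ?_
  obtain ⟨k, hk, hk'⟩ := exists_of_waitingTime_lt (lt_min hr hab)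
  have hkn : k < n := by
    have : (k : ℝ≥0∞) + 1 < n := lt_of_lt_of_le hk' (min_le_right _ _)
    have : k + 1 < n := by exact_mod_cast this
    omega
  exact lt_of_le_of_lt (waitingTime_le (by rw [h k hkn, hk])) (lt_of_lt_of_le hk' (min_le_left _ _))

lemma unroll_eq_of_lt {n : ℕ} (c : ℕ → V → V) :
    ∀ k < n, c k = unroll (fun i : ZMod n × V => c i.1.val i.2) k := by
  intro k hk
  ext u
  simp [unroll, ZMod.val_cast_of_lt hk]

/-- The shift depends on `f`, but for each vertex it only permutes the factors of the mass of a
point, and these have a law independent of time. -/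
lemma pi_singleton_rotate [Fintype V] [MeasurableSpace V] {n : ℕ} [NeZero n]
    (ν : V → Measure V) [∀ u, IsProbabilityMeasure (ν u)] (s : V) (f : ZMod n × V → V) :
    Measure.pi (fun i : ZMod n × V => ν i.2) {rotate s f} =
      Measure.pi (fun i : ZMod n × V => ν i.2) {f} := by
  rw [Measure.pi_singleton, Measure.pi_singleton, Fintype.prod_prod_type_right,
    Fintype.prod_prod_type_right]
  refine Finset.prod_congr rfl fun u _ => ?_
  exact Fintype.prod_equiv (Equiv.addLeft (informTime (unroll f) s u : ZMod n)) _ _ fun k => rfl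

lemma lintegral_min_passage_le [Fintype V] [MeasurableSpace V] [DiscreteMeasurableSpace V]
    (G : SimpleGraph V) (s v : V) {Ω : Type*} [MeasurableSpace Ω] (P : Measure Ω)
    [IsProbabilityMeasure P] (c : ℕ → V → Ω → V) (hm : ∀ t u, Measurable (c t u))
    (ν : V → Measure V) (hlaw : ∀ t u, P.map (c t u) = ν u)
    (hν : ∀ u a, ¬ G.Adj u a → ν u {a} = 0)
    (hindep : iIndepFun (fun i : ℕ × V => c i.1 i.2) P) (n : ℕ) [NeZero n] :
    ∫⁻ ω, min (passage G s v (waitingTime fun t u => c t u ω)) n ∂P ≤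
      ∫⁻ ω, (pushTime (fun t u => c t u ω) s v : ℝ≥0∞) ∂P := by
  classical
  have hprob : ∀ u, IsProbabilityMeasure (ν u) := fun u => by
    rw [← hlaw 0 u]
    exact Measure.isProbabilityMeasure_map (hm 0 u).aemeasurable
  set μ := Measure.pi (fun i : ZMod n × V => ν i.2)
  let X : Ω → ZMod n × V → V := fun ω i => c i.1.val i.2 ω
  have hX : Measurable X := measurable_pi_lambda _ fun i => hm _ _
  have hmap : P.map X = μ := by
    have hinj : Function.Injective (fun i : ZMod n × V => ((i.1.val, i.2) : ℕ × V)) := by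
      rintro ⟨a, b⟩ ⟨a', b'⟩ h
      simp only [Prod.mk.injEq] at h
      exact Prod.ext (ZMod.val_injective n h.1) h.2
    have := (hindep.precomp hinj).map_fun_eq_pi_map (fun i => (hm _ _).aemeasurable)
    simp only [hlaw] at this
    exact this
  have hfin : ∀ g : (ZMod n × V → V) → ℝ≥0∞, ∫⁻ ω, g (X ω) ∂P = ∑ f, g f * μ {f} := by
    intro g
    rw [← lintegral_fintype, ← hmap, lintegral_map Measurable.of_discrete hX]
  calc ∫⁻ ω, min (passage G s v (waitingTime fun t u => c t u ω)) n ∂P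
      ≤ ∫⁻ ω, min (passage G s v (waitingTime (unroll (X ω)))) n ∂P := by
        refine lintegral_mono fun ω => le_min ?_ (min_le_right _ _)
        exact min_passage_waitingTime_le G s v (unroll_eq_of_lt fun t u => c t u ω)
    _ = ∑ f, min (passage G s v (waitingTime (unroll f))) n * μ {f} :=
        hfin fun f => min (passage G s v (waitingTime (unroll f))) n
    _ = ∑ f, min (passage G s v (waitingTime (unroll (rotate s f)))) n * μ {rotate s f} := by
        refine (Fintype.sum_equiv (Equiv.ofBijective (rotate s)
          (Finite.injective_iff_bijective.mp (rotate_injective s))) _ _ fun f => rfl).symm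
    _ ≤ ∑ f, min (pushTime (unroll f) s v : ℝ≥0∞) n * μ {f} := by
        refine Finset.sum_le_sum fun f _ => ?_
        rw [pi_singleton_rotate]
        -- The pathwise bound needs every choice to be a neighbor; all other `f` have mass zero.
        by_cases hf : ∀ i : ZMod n × V, G.Adj i.2 (f i)
        · rw [unroll_rotate]
          gcongr
          exact passage_localChoices_le s v fun t u => hf (t, u)
        · obtain ⟨i, hi⟩ := not_forall.mp hf
          have : μ {f} = 0 := by
            rw [Measure.pi_singleton]
            exact Finset.prod_eq_zero (Finset.mem_univ i) (hν _ _ hi)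
          rw [this, mul_zero, mul_zero]
    _ = ∫⁻ ω, min (pushTime (unroll (X ω)) s v : ℝ≥0∞) n ∂P :=
        (hfin fun f => min (pushTime (unroll f) s v : ℝ≥0∞) n).symm
    _ ≤ _ := lintegral_mono fun ω => min_pushTime_le s v
        fun k hk => (unroll_eq_of_lt (fun t u => c t u ω) k hk).symm

lemma measurable_passage [Finite V] (G : SimpleGraph V) (s v : V) :
    Measurable (passage G s v) := by
  classical
  have := Fintype.ofFinite V
  refine Measurable.iInf fun p => ?_
  induction p.1.darts with
  | nil => simp
  | cons d l ih =>
    simp only [List.map_cons, List.sum_cons]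
    fun_prop

lemma measurable_waitingTime [MeasurableSpace V] [MeasurableSingletonClass V]
    {Ω : Type*} [MeasurableSpace Ω] {c : ℕ → V → Ω → V} (hm : ∀ t u, Measurable (c t u)) :
    Measurable fun ω => waitingTime fun t u => c t u ω := by
  classical
  refine measurable_pi_lambda _ fun a => measurable_pi_lambda _ fun b => ?_
  simp only [waitingTime]
  refine Measurable.iInf fun k => ?_
  have : (fun ω => ⨅ (_ : c k a ω = b), ((k : ℝ≥0∞) + 1)) =
      fun ω => if c k a ω = b then (k : ℝ≥0∞) + 1 else ⊤ := by
    ext ω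
    split_ifs with h <;> simp [h]
  rw [this]
  exact Measurable.ite (hm k a (measurableSet_singleton b)) measurable_const measurable_const

lemma lintegral_passage_waitingTime_le [Fintype V] [MeasurableSpace V] [DiscreteMeasurableSpace V]
    (G : SimpleGraph V) (s v : V) {Ω : Type*} [MeasurableSpace Ω] (P : Measure Ω)
    [IsProbabilityMeasure P] (c : ℕ → V → Ω → V) (hm : ∀ t u, Measurable (c t u))
    (ν : V → Measure V) (hlaw : ∀ t u, P.map (c t u) = ν u)
    (hν : ∀ u a, ¬ G.Adj u a → ν u {a} = 0)
    (hindep : iIndepFun (fun i : ℕ × V => c i.1 i.2) P) :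
    ∫⁻ ω, passage G s v (waitingTime fun t u => c t u ω) ∂P ≤
      ∫⁻ ω, (pushTime (fun t u => c t u ω) s v : ℝ≥0∞) ∂P := by
  have hF : Measurable fun ω => passage G s v (waitingTime fun t u => c t u ω) :=
    (measurable_passage G s v).comp (measurable_waitingTime hm)
  -- Monotone convergence removes the truncation; `n + 1` keeps the period nonzero.
  have hsup : ∀ a : ℝ≥0∞, a = ⨆ n : ℕ, min a ((n + 1 : ℕ) : ℝ≥0∞) := by
    intro a
    refine le_antisymm (le_of_forall_lt fun b hb => ?_) (iSup_le fun n => min_le_left _ _)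
    obtain ⟨n, hn⟩ := ENNReal.exists_nat_gt hb.ne_top
    refine lt_of_lt_of_le (lt_min hb (hn.trans_le ?_)) (le_iSup (fun n : ℕ => min a ((n + 1 : ℕ) : ℝ≥0∞)) n)
    exact_mod_cast Nat.le_succ n
  rw [lintegral_congr fun ω => hsup (passage G s v (waitingTime fun t u => c t u ω)),
    lintegral_iSup (fun n => hF.min measurable_const)]
  · exact iSup_le fun n => lintegral_min_passage_le G s v P c hm ν hlaw hν hindep (n + 1)
  · intro m n hmn ω
    exact min_le_min_left _ (by exact_mod_cast Nat.succ_le_succ hmn)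

/-! ### The standard exponential distribution -/

instance isProbabilityMeasure_expMeasure_one : IsProbabilityMeasure (expMeasure 1) :=
  isProbabilityMeasure_expMeasure one_pos

lemma measurable_exponentialPDF (r : ℝ) : Measurable (exponentialPDF r) :=
  (measurable_exponentialPDFReal r).ennreal_ofReal

lemma expMeasure_eq_withDensity (r : ℝ) :
    expMeasure r = volume.withDensity (exponentialPDF r) := rfl

lemma lintegral_expMeasure_one {f : ℝ → ℝ≥0∞} (hf : Measurable f) :
    ∫⁻ x, f x ∂expMeasure 1 = ∫⁻ x, exponentialPDF 1 x * f x := by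
  rw [expMeasure_eq_withDensity,
    lintegral_withDensity_eq_lintegral_mul _ (measurable_exponentialPDF 1) hf]
  rfl

lemma lintegral_ofReal_expMeasure_one : ∫⁻ x, ENNReal.ofReal x ∂expMeasure 1 = 1 := by
  -- On the positive axis, `x` times the Exp(1) density is the Gamma(2, 1) density, which has mass
  -- `1`.
  rw [lintegral_expMeasure_one ENNReal.measurable_ofReal,
    ← lintegral_gammaPDF_eq_one (a := 2) (r := 1) two_pos one_pos]
  refine lintegral_congr fun x => ?_
  rcases lt_or_ge x 0 with hx | hx
  · simp [exponentialPDF_of_neg hx, gammaPDF_of_neg hx]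
  · rw [exponentialPDF_of_nonneg hx, gammaPDF_of_nonneg hx, ← ENNReal.ofReal_mul (by positivity)]
    have h1 : (2 : ℝ) - 1 = 1 := by norm_num
    rw [h1, Real.rpow_one, Real.Gamma_two]
    congr 1
    simp [mul_comm]

lemma integral_cexp_expMeasure_one (s : ℝ) :
    ∫ x : ℝ, Complex.exp (s * x * Complex.I) ∂expMeasure 1 = (1 - s * Complex.I)⁻¹ := by
  rw [expMeasure_eq_withDensity, integral_withDensity_eq_integral_toReal_smul
    (measurable_exponentialPDF 1)
    (Filter.Eventually.of_forall fun x => ENNReal.ofReal_lt_top)]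
  have h0 : ∀ x : ℝ, (exponentialPDF 1 x).toReal • Complex.exp (s * x * Complex.I) =
      (Set.Ici 0).indicator (fun x : ℝ => Complex.exp ((-1 + s * Complex.I) * x)) x := by
    intro x
    rcases lt_or_ge x 0 with hx | hx
    · rw [exponentialPDF_of_neg hx, Set.indicator_of_notMem (by simpa using hx)]
      simp
    · rw [exponentialPDF_of_nonneg hx, Set.indicator_of_mem (by simpa using hx),
        ENNReal.toReal_ofReal (by positivity), Complex.real_smul]
      simp only [one_mul, Complex.ofReal_exp, ← Complex.exp_add]
      congr 1
      push_cast
      ring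
  simp_rw [h0]
  rw [integral_indicator measurableSet_Ici, integral_Ici_eq_integral_Ioi,
    integral_exp_mul_complex_Ioi (by simp)]
  rw [← neg_sub (s * Complex.I : ℂ) 1, inv_neg, neg_div]
  simp [sub_eq_neg_add]

lemma expMeasure_one_Ioi (x : ℝ) :
    expMeasure 1 (Set.Ioi x) = ENNReal.ofReal (if 0 ≤ x then Real.exp (-x) else 1) := by
  have h := cdf_expMeasure_eq one_pos x
  rw [cdf_eq_real] at h
  rw [← Set.compl_Iic, ← ofReal_measureReal, probReal_compl_eq_one_sub measurableSet_Iic, h]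
  split_ifs <;> simp

lemma map_two_mul_min_expMeasure :
    (Measure.pi fun _ : Bool => expMeasure 1).map
      (fun z => 2 * min (z true) (z false)) = expMeasure 1 := by
  have hm : Measurable fun z : Bool → ℝ => 2 * min (z true) (z false) := by fun_prop
  have := Measure.isProbabilityMeasure_map (μ := Measure.pi fun _ : Bool => expMeasure 1)
    hm.aemeasurable
  refine Measure.ext_of_Iic _ _ fun x => ?_
  rw [← Set.compl_Ioi, prob_compl_eq_one_sub measurableSet_Ioi,
    prob_compl_eq_one_sub measurableSet_Ioi]
  congr 1
  rw [Measure.map_apply hm measurableSet_Ioi]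
  have : (fun z : Bool → ℝ => 2 * min (z true) (z false)) ⁻¹' Set.Ioi x =
      Set.univ.pi fun _ => Set.Ioi (x / 2) := by
    ext z
    simp only [Set.mem_preimage, Set.mem_Ioi, Set.mem_univ_pi, Bool.forall_bool,
      div_lt_iff₀' (two_pos : (0 : ℝ) < 2), mul_min_of_nonneg _ _ (zero_le_two : (0 : ℝ) ≤ 2),
      lt_min_iff, and_comm]
  rw [this, Measure.pi_pi, Fintype.prod_bool, expMeasure_one_Ioi, expMeasure_one_Ioi,
    ← ENNReal.ofReal_mul (by split_ifs <;> positivity)]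
  congr 1
  have : 0 ≤ x / 2 ↔ 0 ≤ x := by constructor <;> intro h <;> linarith
  simp only [this]
  split_ifs
  · rw [← Real.exp_add]
    ring_nf
  · simp

/-! ### Thinning: the first ring at each vertex -/

/-- The independent exponential weights on the darts, with rate `1 / deg` on the darts leaving a
vertex, as a function of standard exponential variables. Pairs that are not darts have
weight `0`. -/
def scaled [Fintype V] (G : SimpleGraph V) [DecidableRel G.Adj] (y : V × V → ℝ) : V × V → ℝ :=
  fun i => if G.Adj i.1 i.2 then G.degree i.1 * y i else 0

open scoped Classical in
/-- The weights on the darts when the clock of `u` rings first at time `τ u`, the dart chosen at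
that time is `(u, b u)`, and the remaining darts start afresh at that time. -/
def resampled [Fintype V] (G : SimpleGraph V) [DecidableRel G.Adj] (b : V → V) (y : V × V → ℝ)
    (τ : V → ℝ) : V × V → ℝ :=
  fun i => if G.Adj i.1 i.2 then τ i.1 + (if b i.1 = i.2 then 0 else G.degree i.1 * y i) else 0

lemma measurable_scaled [Fintype V] (G : SimpleGraph V) [DecidableRel G.Adj] :
    Measurable (scaled G) := by
  refine measurable_pi_lambda _ fun i => ?_
  simp only [scaled]
  split_ifs <;> fun_prop

lemma measurable_resampled [Fintype V] [MeasurableSpace V] [MeasurableSingletonClass V]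
    (G : SimpleGraph V) [DecidableRel G.Adj] :
    Measurable fun q : (V → V) × (V × V → ℝ) × (V → ℝ) => resampled G q.1 q.2.1 q.2.2 := by
  classical
  refine measurable_pi_lambda _ fun i => ?_
  simp only [resampled]
  split_ifs
  · refine Measurable.add (by fun_prop) (Measurable.ite ?_ (by fun_prop) (by fun_prop))
    have : Measurable fun q : (V → V) × (V × V → ℝ) × (V → ℝ) => q.1 i.1 := by fun_prop
    exact this (measurableSet_singleton i.2)
  · fun_prop

lemma integral_uniformOn_neighborSet [Fintype V] [MeasurableSpace V] [DiscreteMeasurableSpace V]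
    (G : SimpleGraph V) [DecidableRel G.Adj] (u : V) (g : V → ℂ) :
    ∫ a, g a ∂(uniformOn (G.neighborSet u)) =
      (G.degree u : ℂ)⁻¹ * ∑ a ∈ G.neighborFinset u, g a := by
  classical
  have : ∀ a, (uniformOn (G.neighborSet u)).real {a} =
      if a ∈ G.neighborFinset u then (G.degree u : ℝ)⁻¹ else 0 := by
    intro a
    have h := uniformOn_apply_finset (s := G.neighborFinset u) (t := {a})
    rw [SimpleGraph.coe_neighborFinset, Finset.coe_singleton] at h
    rw [measureReal_def, h]
    split_ifs with ha
    · rw [Finset.inter_singleton_of_mem ha]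
      simp
    · rw [Finset.inter_singleton_of_notMem ha]
      simp
  have hfin : IsFiniteMeasure (uniformOn (G.neighborSet u)) := by
    unfold uniformOn; infer_instance
  rw [integral_fintype (Integrable.of_finite), Finset.mul_sum, ← Finset.sum_filter_add_sum_filter_not
    Finset.univ (· ∈ G.neighborFinset u)]
  rw [Finset.sum_eq_zero (s := Finset.univ.filter (· ∉ G.neighborFinset u)), add_zero,
    Finset.filter_univ_mem]
  · refine Finset.sum_congr rfl fun a ha => ?_
    rw [this, if_pos ha, Complex.real_smul]
    push_cast
    rfl
  · intro a ha
    rw [this, if_neg (Finset.mem_filter.mp ha).2, zero_smul]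

lemma one_sub_ofReal_mul_I_ne_zero (x : ℝ) : (1 - x * Complex.I : ℂ) ≠ 0 := by
  intro h
  have := congrArg Complex.re h
  simp at this

/-- The identity of characteristic functions behind the thinning of a Poisson process. -/
lemma inv_mul_sum_prod_eq [Fintype V] [DecidableEq V] (G : SimpleGraph V) [DecidableRel G.Adj]
    (u : V) (hu : G.degree u ≠ 0) (r : V → ℝ) (hr : ∀ a, ¬ G.Adj u a → r a = 0) :
    (1 - (∑ a, r a : ℝ) * Complex.I)⁻¹ * ((G.degree u : ℂ)⁻¹ * ∑ b ∈ G.neighborFinset u,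
      ∏ a, (1 - (r a * (if b = a then 0 else (G.degree u : ℝ)) : ℝ) * Complex.I)⁻¹) =
      ∏ a, (1 - (r a * G.degree u : ℝ) * Complex.I)⁻¹ := by
  -- Setting the weight of the chosen dart `b` to zero removes one factor from the full product;
  -- summing the removed factors over `b` cancels the transform of the ringing time.
  have hb : ∀ b, ∏ a, (1 - (r a * (if b = a then 0 else (G.degree u : ℝ)) : ℝ) * Complex.I)⁻¹ =
      (∏ a, (1 - (r a * G.degree u : ℝ) * Complex.I)⁻¹) *
        (1 - (r b * G.degree u : ℝ) * Complex.I) := by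
    intro b
    rw [← Finset.mul_prod_erase _ _ (Finset.mem_univ b),
      ← Finset.mul_prod_erase _ (fun a => (1 - (r a * G.degree u : ℝ) * Complex.I)⁻¹)
        (Finset.mem_univ b), mul_right_comm, inv_mul_cancel₀ (one_sub_ofReal_mul_I_ne_zero _)]
    simp only [if_true, mul_zero, Complex.ofReal_zero, zero_mul, sub_zero, inv_one, one_mul]
    refine Finset.prod_congr rfl fun a ha => ?_
    rw [if_neg (Finset.ne_of_mem_erase ha).symm]
  have hd : (G.degree u : ℂ) ≠ 0 := Nat.cast_ne_zero.mpr hu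
  have hsum : ∑ b ∈ G.neighborFinset u, (1 - (r b * G.degree u : ℝ) * Complex.I) =
      G.degree u * (1 - (∑ a, r a : ℝ) * Complex.I) := by
    have : ∑ a, r a = ∑ a ∈ G.neighborFinset u, r a := by
      refine (Finset.sum_subset (Finset.subset_univ _) fun a _ ha => hr a ?_).symm
      simpa using ha
    rw [Finset.sum_sub_distrib, this]
    simp only [Finset.sum_const, SimpleGraph.card_neighborFinset_eq_degree, nsmul_eq_mul, mul_one,
      mul_sub, Complex.ofReal_sum, Finset.sum_mul, Finset.mul_sum]
    congr 1
    refine Finset.sum_congr rfl fun a _ => ?_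
    push_cast
    ring
  simp_rw [hb, ← Finset.mul_sum, hsum]
  have h1 := one_sub_ofReal_mul_I_ne_zero (∑ a, r a)
  generalize (1 - (∑ a, r a : ℝ) * Complex.I : ℂ) = z at h1 ⊢
  generalize ∏ a, (1 - (r a * G.degree u : ℝ) * Complex.I : ℂ)⁻¹ = q
  field_simp

/-- Both characteristic functions factor over the vertices, and the factors agree by
`inv_mul_sum_prod_eq`. This replaces a direct argument from memorylessness. -/
lemma map_resampled_eq_map_scaled [Fintype V] [MeasurableSpace V] [DiscreteMeasurableSpace V]
    (G : SimpleGraph V) [DecidableRel G.Adj] (hG : ∀ u, G.degree u ≠ 0) :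
    ((Measure.pi fun u => uniformOn (G.neighborSet u)).prod
      ((Measure.pi fun _ : V × V => expMeasure 1).prod (Measure.pi fun _ : V => expMeasure 1))).map
        (fun q => resampled G q.1 q.2.1 q.2.2) =
      (Measure.pi fun _ : V × V => expMeasure 1).map (scaled G) := by
  classical
  have hp : ∀ u, IsProbabilityMeasure (uniformOn (G.neighborSet u)) := fun u =>
    isProbabilityMeasure_uniformOn (Set.toFinite _) (by
      obtain ⟨a, ha⟩ := (G.degree_pos_iff_exists_adj u).mp (Nat.pos_of_ne_zero (hG u))
      exact ⟨a, ha⟩)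
  refine Measure.ext_of_charFunDual (funext fun L => ?_)
  have hL : ∀ x, L x = ∑ i, x i * L (Pi.single i 1) := fun x => by
    conv_lhs => rw [← Finset.univ_sum_single x, map_sum]
    refine Finset.sum_congr rfl fun i _ => ?_
    rw [← smul_eq_mul, ← map_smul, ← Pi.single_smul, smul_eq_mul, mul_one]
  rw [charFunDual_apply, charFunDual_apply, integral_map (measurable_resampled G).aemeasurable
    (by fun_prop), integral_map (measurable_scaled G).aemeasurable (by fun_prop)]
  set r : V → V → ℝ := fun u a => if G.Adj u a then L (Pi.single (u, a) 1) else 0 with hr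
  have hscaled : ∀ y : V × V → ℝ, Complex.exp (L (scaled G y) * Complex.I) =
      ∏ i : V × V, Complex.exp ((r i.1 i.2 * G.degree i.1 : ℝ) * y i * Complex.I) := by
    intro y
    rw [hL, ← Complex.exp_sum, ← Finset.sum_mul, Complex.ofReal_sum]
    congr 2
    refine Finset.sum_congr rfl fun i _ => ?_
    simp only [scaled, hr]
    split_ifs <;> push_cast <;> ring
  -- Every dart out of `u` contains the same `τ u`, whose coefficient is therefore the sum of `r u
  -- a` over `a`.
  have hres : ∀ b y τ, Complex.exp (L (resampled G b y τ) * Complex.I) =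
      (∏ i : V × V, Complex.exp
        ((r i.1 i.2 * (if b i.1 = i.2 then 0 else (G.degree i.1 : ℝ)) : ℝ) * y i * Complex.I)) *
      ∏ u, Complex.exp ((∑ a, r u a : ℝ) * τ u * Complex.I) := by
    intro b y τ
    have hS : ∑ u, ((∑ a, r u a : ℝ) : ℂ) * τ u = ∑ i : V × V, (r i.1 i.2 : ℂ) * τ i.1 := by
      rw [Fintype.sum_prod_type]
      simp_rw [Complex.ofReal_sum, Finset.sum_mul]
    rw [hL, ← Complex.exp_sum, ← Complex.exp_sum, ← Complex.exp_add, ← Finset.sum_mul,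
      ← Finset.sum_mul, ← add_mul, hS, ← Finset.sum_add_distrib, Complex.ofReal_sum]
    congr 2
    refine Finset.sum_congr rfl fun i _ => ?_
    simp only [resampled, hr]
    split_ifs <;> push_cast <;> ring
  have hinner : ∀ b, ∫ q, Complex.exp (L (resampled G b q.1 q.2) * Complex.I)
      ∂((Measure.pi fun _ : V × V => expMeasure 1).prod (Measure.pi fun _ : V => expMeasure 1)) =
      ∏ u, (1 - (∑ a, r u a : ℝ) * Complex.I)⁻¹ *
        ∏ a, (1 - (r u a * (if b u = a then 0 else (G.degree u : ℝ)) : ℝ) * Complex.I)⁻¹ := by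
    intro b
    simp_rw [hres]
    rw [integral_prod_mul (fun y : V × V → ℝ => ∏ i : V × V, Complex.exp
        ((r i.1 i.2 * (if b i.1 = i.2 then 0 else (G.degree i.1 : ℝ)) : ℝ) * y i * Complex.I))
      (fun τ : V → ℝ => ∏ u, Complex.exp ((∑ a, r u a : ℝ) * τ u * Complex.I)),
      integral_fintype_prod_eq_prod (fun (i : V × V) (t : ℝ) => Complex.exp
        ((r i.1 i.2 * (if b i.1 = i.2 then 0 else (G.degree i.1 : ℝ)) : ℝ) * t * Complex.I)),
      integral_fintype_prod_eq_prod (fun (u : V) (t : ℝ) => Complex.exp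
        ((∑ a, r u a : ℝ) * t * Complex.I))]
    simp_rw [integral_cexp_expMeasure_one]
    rw [Fintype.prod_prod_type, Finset.prod_mul_distrib, mul_comm]
  rw [integral_prod]
  · simp_rw [hinner, hscaled]
    rw [integral_fintype_prod_eq_prod (fun (u : V) (a : V) => (1 - (∑ a, r u a : ℝ) * Complex.I)⁻¹ *
        ∏ a', (1 - (r u a' * (if a = a' then 0 else (G.degree u : ℝ)) : ℝ) * Complex.I)⁻¹),
      integral_fintype_prod_eq_prod (fun (i : V × V) (t : ℝ) =>
        Complex.exp ((r i.1 i.2 * G.degree i.1 : ℝ) * t * Complex.I))]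
    simp_rw [integral_cexp_expMeasure_one]
    rw [Fintype.prod_prod_type]
    refine Finset.prod_congr rfl fun u _ => ?_
    rw [integral_const_mul, integral_uniformOn_neighborSet]
    exact inv_mul_sum_prod_eq G u (hG u) (r u) fun a ha => if_neg ha
  · refine Integrable.of_bound ?_ 1 (Filter.Eventually.of_forall fun q => ?_)
    · exact ((by fun_prop : Measurable fun x : V × V → ℝ => Complex.exp (L x * Complex.I)).comp
        (measurable_resampled G)).aestronglyMeasurable
    · rw [Complex.norm_exp_ofReal_mul_I]

/-! ### Replacing exponential weights by waiting times, step by step -/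

open scoped Classical in
/-- The waiting times seen one step earlier: in this step, `u` chooses `b u`. -/
def step (b : V → V) (y : V → V → ℝ≥0∞) : V → V → ℝ≥0∞ :=
  fun u v => 1 + if b u = v then 0 else y u v

/-- The waiting times when in the first `n` steps the choices are given by `c`, and the remaining
waiting times after these `n` steps are given by `y`. -/
def delayed (c : ℕ → V → V) : ℕ → (V → V → ℝ≥0∞) → V → V → ℝ≥0∞
  | 0, y => y
  | n + 1, y => delayed c n (step (c n) y)

lemma delayed_le_add (c : ℕ → V → V) (n : ℕ) (y : V → V → ℝ≥0∞) (u v : V) :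
    delayed c n y u v ≤ n + y u v := by
  induction n generalizing y with
  | zero => simp [delayed]
  | succ n ih =>
    refine (ih _).trans ?_
    rw [Nat.cast_succ, add_assoc]
    gcongr
    simp only [step]
    split_ifs <;> simp

lemma delayed_le_of_eq {c : ℕ → V → V} {n k : ℕ} (hk : k < n) (y : V → V → ℝ≥0∞) {u v : V}
    (h : c k u = v) : delayed c n y u v ≤ k + 1 := by
  induction n generalizing y with
  | zero => omega
  | succ n ih =>
    rcases Nat.lt_succ_iff_lt_or_eq.mp hk with hk | rfl
    · exact ih hk _
    · refine (delayed_le_add c k (step (c k) y) u v).trans ?_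
      simp [step, h]

lemma delayed_congr {c c' : ℕ → V → V} {n : ℕ} (h : ∀ k < n, c k = c' k) :
    delayed c n = delayed c' n := by
  induction n with
  | zero => rfl
  | succ n ih =>
    ext y u v
    rw [delayed, delayed, ih fun k hk => h k (by omega), h n (by omega)]

lemma delayed_mono (c : ℕ → V → V) (n : ℕ) : Monotone (delayed c n) := by
  induction n with
  | zero => exact monotone_id
  | succ n ih =>
    intro y y' h
    refine ih fun u v => ?_
    simp only [step]
    split_ifs
    · rfl
    · gcongr
      exact h u v

lemma measurable_step (b : V → V) : Measurable (step b) := by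
  refine measurable_pi_lambda _ fun u => measurable_pi_lambda _ fun v => ?_
  simp only [step]
  split_ifs <;> fun_prop

lemma measurable_delayed (c : ℕ → V → V) (n : ℕ) : Measurable (delayed c n) := by
  induction n with
  | zero => exact measurable_id
  | succ n ih => exact ih.comp (measurable_step (c n))

/-- Each entry of `delayed c n y` is a constant, or a constant plus the same entry of `y`, so it
commutes with averaging. -/
lemma lintegral_delayed {T : Type*} [MeasurableSpace T] (μ : Measure T) [IsProbabilityMeasure μ]
    (c : ℕ → V → V) (n : ℕ) {y : T → V → V → ℝ≥0∞} (hy : Measurable y) (u v : V) :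
    ∫⁻ t, delayed c n (y t) u v ∂μ = delayed c n (fun a b => ∫⁻ t, y t a b ∂μ) u v := by
  induction n generalizing y with
  | zero => rfl
  | succ n ih =>
    refine (ih ((measurable_step (c n)).comp hy)).trans ?_
    rw [delayed]
    congr 1
    ext a b
    simp only [Function.comp, step]
    rw [lintegral_add_left measurable_const]
    split_ifs <;> simp

/-- Jensen's inequality for an infimum of linear functions. -/
lemma lintegral_passage_le (G : SimpleGraph V) (s v : V) {T : Type*} [MeasurableSpace T]
    (μ : Measure T) {x : T → V → V → ℝ≥0∞} (hx : Measurable x) :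
    ∫⁻ t, passage G s v (x t) ∂μ ≤ passage G s v fun a b => ∫⁻ t, x t a b ∂μ := by
  refine le_iInf fun p => (lintegral_mono fun t => iInf_le _ p).trans (le_of_eq ?_)
  have hx' : ∀ a b, Measurable fun t => x t a b := fun a b => by fun_prop
  induction p.1.darts with
  | nil => simp
  | cons d l ih =>
    simp only [List.map_cons, List.sum_cons]
    rw [lintegral_add_left (hx' _ _), ih]

/-- A family of real weights on pairs, as nonnegative extended weights. -/
def toWeights (x : V × V → ℝ) : V → V → ℝ≥0∞ := fun u v => ENNReal.ofReal (x (u, v))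

lemma measurable_toWeights : Measurable (toWeights (V := V)) := by
  refine measurable_pi_lambda _ fun u => measurable_pi_lambda _ fun v => ?_
  simp only [toWeights]
  fun_prop

lemma lintegral_pi_ofReal_eval {ι : Type*} [Fintype ι] (i : ι) :
    ∫⁻ y, ENNReal.ofReal (y i) ∂(Measure.pi fun _ : ι => expMeasure 1) = 1 := by
  rw [(measurePreserving_eval (fun _ : ι => expMeasure 1) i).lintegral_comp
    ENNReal.measurable_ofReal, lintegral_ofReal_expMeasure_one]

lemma lintegral_resampled_le [Fintype V] (G : SimpleGraph V) [DecidableRel G.Adj] (b : V → V)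
    (y : V × V → ℝ) (u v : V) :
    ∫⁻ τ, toWeights (resampled G b y τ) u v ∂(Measure.pi fun _ : V => expMeasure 1) ≤
      step b (toWeights (scaled G y)) u v := by
  classical
  simp only [toWeights, resampled, step, scaled]
  by_cases h : G.Adj u v
  · simp only [h, if_true]
    refine (lintegral_mono fun τ => ENNReal.ofReal_add_le).trans ?_
    rw [lintegral_add_left (by fun_prop), lintegral_pi_ofReal_eval]
    split_ifs <;> simp
  · simp [h]

/-- One step of the comparison: the exponential weights are replaced by one step of uniform
choices followed by fresh exponential weights. -/
lemma lintegral_delayed_scaled_le [Fintype V] [MeasurableSpace V] [DiscreteMeasurableSpace V]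
    (G : SimpleGraph V) [DecidableRel G.Adj] (hG : ∀ u, G.degree u ≠ 0) (s v : V)
    (c : ℕ → V → V) (n : ℕ) :
    ∫⁻ y, passage G s v (delayed c n (toWeights (scaled G y)))
        ∂(Measure.pi fun _ : V × V => expMeasure 1) ≤
      ∫⁻ b, ∫⁻ y, passage G s v (delayed c n (step b (toWeights (scaled G y))))
        ∂(Measure.pi fun _ : V × V => expMeasure 1)
        ∂(Measure.pi fun u => uniformOn (G.neighborSet u)) := by
  have hp : ∀ u, IsProbabilityMeasure (uniformOn (G.neighborSet u)) := fun u =>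
    isProbabilityMeasure_uniformOn (Set.toFinite _) (by
      obtain ⟨a, ha⟩ := (G.degree_pos_iff_exists_adj u).mp (Nat.pos_of_ne_zero (hG u))
      exact ⟨a, ha⟩)
  have hH : Measurable fun x => passage G s v (delayed c n (toWeights x)) :=
    (measurable_passage G s v).comp ((measurable_delayed c n).comp measurable_toWeights)
  rw [← lintegral_map hH (measurable_scaled G), ← map_resampled_eq_map_scaled G hG,
    lintegral_map hH (measurable_resampled G)]
  refine (lintegral_prod _ (hH.comp (measurable_resampled G)).aemeasurable).le.trans ?_
  refine lintegral_mono fun b => ?_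
  have hb : Measurable fun q : (V × V → ℝ) × (V → ℝ) => resampled G b q.1 q.2 :=
    (measurable_resampled G).comp (measurable_const.prodMk measurable_id)
  refine (lintegral_prod _ (hH.comp hb).aemeasurable).le.trans (lintegral_mono fun y => ?_)
  have hy : Measurable fun τ => toWeights (resampled G b y τ) :=
    measurable_toWeights.comp (hb.comp (measurable_const.prodMk measurable_id))
  -- With `b` and `y` fixed, only the ringing times are averaged; their mean `1` is the duration of
  -- one push step.
  refine (lintegral_passage_le G s v _ ((measurable_delayed c n).comp hy)).trans ?_
  refine passage_mono G fun u a => ?_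
  refine (lintegral_delayed _ c n hy u a).le.trans ?_
  exact delayed_mono c n (fun u a => lintegral_resampled_le G b y u a) u a

/-- The choices in step `n + 1` are independent of those in the first `n` steps. -/
lemma lintegral_lintegral_choice_eq [Fintype V] [MeasurableSpace V] [DiscreteMeasurableSpace V]
    {Ω : Type*} [MeasurableSpace Ω] (P : Measure Ω) [IsProbabilityMeasure P]
    (c : ℕ → V → Ω → V) (hm : ∀ t u, Measurable (c t u))
    (ν : V → Measure V) (hlaw : ∀ t u, P.map (c t u) = ν u)
    (hindep : iIndepFun (fun i : ℕ × V => c i.1 i.2) P) (n : ℕ)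
    (K : (ℕ → V → V) → (V → V) → ℝ≥0∞)
    (hK : ∀ c c' : ℕ → V → V, (∀ k < n, c k = c' k) → K c = K c') :
    ∫⁻ ω, ∫⁻ b, K (fun t u => c t u ω) b ∂(Measure.pi ν) ∂P =
      ∫⁻ ω, K (fun t u => c t u ω) (fun u => c n u ω) ∂P := by
  classical
  have hprob : ∀ u, IsProbabilityMeasure (ν u) := fun u => by
    rw [← hlaw 0 u]
    exact Measure.isProbabilityMeasure_map (hm 0 u).aemeasurable
  let X : Ω → Fin n × V → V := fun ω i => c i.1 i.2 ω
  let B : Ω → V → V := fun ω u => c n u ω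
  -- The value `u` from step `n` on is arbitrary, since `K` ignores those choices.
  let E : (Fin n × V → V) → ℕ → V → V := fun p k u => if h : k < n then p (⟨k, h⟩, u) else u
  have hX : Measurable X := measurable_pi_lambda _ fun i => hm _ _
  have hB : Measurable B := measurable_pi_lambda _ fun i => hm _ _
  have hE : ∀ ω, K (fun t u => c t u ω) = K (E (X ω)) := fun ω =>
    hK _ _ fun k hk => by ext u; simp [E, X, hk]
  have hBlaw : P.map B = Measure.pi ν := by
    have hinj : Function.Injective (fun u : V => ((n, u) : ℕ × V)) := fun a b h => by
      simpa using h
    have := (hindep.precomp hinj).map_fun_eq_pi_map (fun i => (hm _ _).aemeasurable)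
    simp only [hlaw] at this
    exact this
  have hXB : IndepFun X B P := by
    have h := hindep.indepFun_finset (Finset.range n ×ˢ Finset.univ) ({n} ×ˢ Finset.univ)
      (by
        rw [Finset.disjoint_left]
        rintro ⟨a, b⟩ h1 h2
        simp only [Finset.mem_product, Finset.mem_range, Finset.mem_singleton] at h1 h2
        omega) (fun i => hm _ _)
    exact h.comp
      (φ := fun f (i : Fin n × V) => f ⟨((i.1 : ℕ), i.2), by simp⟩)
      (ψ := fun f (u : V) => f ⟨(n, u), by simp⟩)
      (measurable_pi_lambda _ fun _ => measurable_pi_apply _)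
      (measurable_pi_lambda _ fun _ => measurable_pi_apply _)
  have hpair := hXB.map_prod_eq_prod_map_map hX.aemeasurable hB.aemeasurable
  simp_rw [hE]
  have hKm : Measurable fun q : (Fin n × V → V) × (V → V) => K (E q.1) q.2 := .of_discrete
  calc ∫⁻ ω, ∫⁻ b, K (E (X ω)) b ∂(Measure.pi ν) ∂P
      = ∫⁻ p, ∫⁻ b, K (E p) b ∂(Measure.pi ν) ∂(P.map X) :=
        (lintegral_map (f := fun p => ∫⁻ b, K (E p) b ∂(Measure.pi ν)) .of_discrete hX).symm
    _ = ∫⁻ q, K (E q.1) q.2 ∂((P.map X).prod (P.map B)) := by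
        rw [hBlaw, lintegral_prod _ hKm.aemeasurable]
    _ = ∫⁻ ω, K (E (X ω)) (B ω) ∂P := by
        rw [← hpair, lintegral_map hKm (hX.prodMk hB)]

lemma lintegral_passage_scaled_le_delayed [Fintype V] [MeasurableSpace V]
    [DiscreteMeasurableSpace V] (G : SimpleGraph V) [DecidableRel G.Adj]
    (hG : ∀ u, G.degree u ≠ 0) (s v : V)
    {Ω : Type*} [MeasurableSpace Ω] (P : Measure Ω) [IsProbabilityMeasure P]
    (c : ℕ → V → Ω → V) (hm : ∀ t u, Measurable (c t u))
    (hlaw : ∀ t u, P.map (c t u) = uniformOn (G.neighborSet u))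
    (hindep : iIndepFun (fun i : ℕ × V => c i.1 i.2) P) (n : ℕ) :
    ∫⁻ y, passage G s v (toWeights (scaled G y)) ∂(Measure.pi fun _ : V × V => expMeasure 1) ≤
      ∫⁻ ω, ∫⁻ y, passage G s v (delayed (fun t u => c t u ω) n (toWeights (scaled G y)))
        ∂(Measure.pi fun _ : V × V => expMeasure 1) ∂P := by
  induction n with
  | zero => simp [delayed]
  | succ n ih =>
    refine ih.trans ?_
    refine (lintegral_mono fun ω => lintegral_delayed_scaled_le G hG s v _ n).trans (le_of_eq ?_)
    exact lintegral_lintegral_choice_eq P c hm _ hlaw hindep n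
      (fun c b => ∫⁻ y, passage G s v (delayed c n (step b (toWeights (scaled G y))))
        ∂(Measure.pi fun _ : V × V => expMeasure 1))
      (fun c c' h => by simp_rw [delayed_congr h])

lemma lintegral_scaled_le [Fintype V] (G : SimpleGraph V) [DecidableRel G.Adj] (u v : V) :
    ∫⁻ y, toWeights (scaled G y) u v ∂(Measure.pi fun _ : V × V => expMeasure 1) ≤
      Fintype.card V := by
  simp only [toWeights, scaled]
  split_ifs
  · simp_rw [ENNReal.ofReal_mul (Nat.cast_nonneg _), ENNReal.ofReal_natCast]
    rw [lintegral_const_mul _ (by fun_prop), lintegral_pi_ofReal_eval, mul_one]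
    exact_mod_cast (G.degree_lt_card_verts u).le
  · simp

/-- Every dart that matters has been chosen within the first `n` steps, so the remaining weights `y`
no longer enter its cost. -/
lemma passage_delayed_le_waitingTime (G : SimpleGraph V) {s v : V} {c : ℕ → V → V} {n : ℕ}
    (h : passage G s v (waitingTime c) < n) (y : V → V → ℝ≥0∞) :
    passage G s v (delayed c n y) ≤ passage G s v (waitingTime c) := by
  refine passage_le_passage_of_lt h fun a b _ hab => le_of_forall_gt fun r hr => ?_
  obtain ⟨k, hk, hk'⟩ := exists_of_waitingTime_lt (lt_min hr hab)
  have hkn : k < n := by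
    have : (k : ℝ≥0∞) + 1 < n := lt_of_lt_of_le hk' (min_le_right _ _)
    have : k + 1 < n := by exact_mod_cast this
    omega
  exact lt_of_le_of_lt (delayed_le_of_eq hkn y hk) (lt_of_lt_of_le hk' (min_le_left _ _))

/-- A crude bound, linear in `n`, for the event that the waiting-time passage takes at least `n`
steps. -/
lemma lintegral_passage_delayed_le [Fintype V] (G : SimpleGraph V) [DecidableRel G.Adj]
    {s v : V} (p : G.Walk s v) (c : ℕ → V → V) (n : ℕ) :
    ∫⁻ y, passage G s v (delayed c n (toWeights (scaled G y)))
        ∂(Measure.pi fun _ : V × V => expMeasure 1) ≤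
      p.length * (n + Fintype.card V) := by
  have hm : Measurable fun y => toWeights (scaled G y) :=
    measurable_toWeights.comp (measurable_scaled G)
  refine (lintegral_passage_le G s v _ ((measurable_delayed c n).comp hm)).trans ?_
  refine (passage_le_walk G _ p).trans ?_
  refine (list_map_sum_mono _ (g := fun _ => (n : ℝ≥0∞) + Fintype.card V) fun d _ => ?_).trans ?_
  · refine (lintegral_delayed _ c n hm d.fst d.snd).le.trans ((delayed_le_add _ _ _ _ _).trans ?_)
    gcongr
    exact lintegral_scaled_le G _ _
  · simp [List.map_const', List.sum_replicate, mul_add]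

/-- The directed first-passage time with exponential weights is at most, on average, that with
the waiting times of the push algorithm. -/
lemma lintegral_passage_scaled_le [Fintype V] [MeasurableSpace V] [DiscreteMeasurableSpace V]
    (G : SimpleGraph V) [DecidableRel G.Adj] (hG : ∀ u, G.degree u ≠ 0) {s v : V}
    (p : G.Walk s v) {Ω : Type*} [MeasurableSpace Ω] (P : Measure Ω) [IsProbabilityMeasure P]
    (c : ℕ → V → Ω → V) (hm : ∀ t u, Measurable (c t u))
    (hlaw : ∀ t u, P.map (c t u) = uniformOn (G.neighborSet u))
    (hindep : iIndepFun (fun i : ℕ × V => c i.1 i.2) P) :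
    ∫⁻ y, passage G s v (toWeights (scaled G y)) ∂(Measure.pi fun _ : V × V => expMeasure 1) ≤
      ∫⁻ ω, passage G s v (waitingTime fun t u => c t u ω) ∂P := by
  set f : Ω → ℝ≥0∞ := fun ω => passage G s v (waitingTime fun t u => c t u ω) with hf
  have hfm : Measurable f := (measurable_passage G s v).comp (measurable_waitingTime hm)
  by_cases hfin : ∫⁻ ω, f ω ∂P = ⊤
  · rw [hfin]; exact le_top
  -- The error on the event `n ≤ f` is dominated by `p.length * (f + |V|)`, which is integrable, and
  -- vanishes eventually wherever `f` is finite.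
  let e : ℕ → Ω → ℝ≥0∞ := fun n =>
    {ω | (n : ℝ≥0∞) ≤ f ω}.indicator fun _ => p.length * (n + Fintype.card V)
  have hem : ∀ n, Measurable (e n) := fun n =>
    measurable_const.indicator (measurableSet_le measurable_const hfm)
  have hbound : ∀ n, ∫⁻ y, passage G s v (toWeights (scaled G y))
      ∂(Measure.pi fun _ : V × V => expMeasure 1) ≤ ∫⁻ ω, f ω ∂P + ∫⁻ ω, e n ω ∂P := by
    intro n
    refine (lintegral_passage_scaled_le_delayed G hG s v P c hm hlaw hindep n).trans ?_
    rw [← lintegral_add_left hfm]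
    refine lintegral_mono fun ω => ?_
    rcases lt_or_ge (f ω) n with h | h
    · refine le_add_right ?_
      refine (lintegral_mono fun y => passage_delayed_le_waitingTime G h _).trans ?_
      simp [hf]
    · refine le_add_left ((lintegral_passage_delayed_le G p _ n).trans ?_)
      simp only [e]
      rw [Set.indicator_of_mem (by exact h)]
  have hlim : Filter.Tendsto (fun n => ∫⁻ ω, e n ω ∂P) Filter.atTop (nhds (∫⁻ _, 0 ∂P)) := by
    refine tendsto_lintegral_of_dominated_convergence
      (fun ω => p.length * (f ω + Fintype.card V)) hem (fun n => ?_) ?_ ?_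
    · refine Filter.Eventually.of_forall fun ω => ?_
      refine Set.indicator_le' (g := fun ω => p.length * (f ω + Fintype.card V))
        (fun ω hω => ?_) (fun _ _ => zero_le) ω
      gcongr
      exact hω
    · rw [lintegral_const_mul _ (by fun_prop), lintegral_add_right _ measurable_const]
      refine ENNReal.mul_ne_top (ENNReal.natCast_ne_top _) (ENNReal.add_ne_top.mpr ⟨hfin, ?_⟩)
      simp
    · filter_upwards [ae_lt_top hfm hfin] with ω hω
      obtain ⟨N, hN⟩ := ENNReal.exists_nat_gt hω.ne
      refine tendsto_const_nhds.congr' ?_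
      filter_upwards [Filter.eventually_ge_atTop N] with n hn
      simp only [e]
      rw [Set.indicator_of_notMem]
      simp only [Set.mem_ofPred_eq, not_le]
      exact hN.trans_le (by exact_mod_cast hn)
  have := ge_of_tendsto' (hlim.const_add (∫⁻ ω, f ω ∂P)) hbound
  simpa using this

/-! ### From directed to undirected percolation -/

lemma measurable_list_map_sum {α T : Type*} [MeasurableSpace T] (l : List α) {f : α → T → ℝ}
    (hf : ∀ a, Measurable (f a)) : Measurable fun t => (l.map fun a => f a t).sum := by
  induction l with
  | nil => simp
  | cons a l ih =>
    simp only [List.map_cons, List.sum_cons]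
    exact (hf a).add ih

lemma measurable_ufpp [Finite V] (G : SimpleGraph V) (s v : V) :
    Measurable fun w : G.edgeSet → ℝ => ufpp G w s v := by
  classical
  have := Fintype.ofFinite V
  refine Measurable.iInf fun p => Measurable.ennreal_ofReal ?_
  exact measurable_list_map_sum _ fun e => measurable_pi_apply _

lemma ofReal_list_map_sum_le {α : Type*} (l : List α) (f : α → ℝ) :
    ENNReal.ofReal (l.map f).sum ≤ (l.map fun a => ENNReal.ofReal (f a)).sum := by
  induction l with
  | nil => simp
  | cons a l ih =>
    simp only [List.map_cons, List.sum_cons]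
    exact ENNReal.ofReal_add_le.trans (by gcongr)

/-- Twice the minimum of the weights of the two darts of an edge. -/
def edgeMin (y : V × V → ℝ) (e : Sym2 V) : ℝ := 2 * min (y (Quot.out e)) (y (Quot.out e).swap)

lemma edgeMin_mk_le (y : V × V → ℝ) (a b : V) : edgeMin y s(a, b) ≤ 2 * y (a, b) := by
  have h : s((Quot.out s(a, b)).1, (Quot.out s(a, b)).2) = s(a, b) := Quot.out_eq s(a, b)
  rw [edgeMin]
  gcongr
  rcases Sym2.eq_iff.mp h with ⟨h1, h2⟩ | ⟨h1, h2⟩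
  · exact (min_le_left _ _).trans_eq (congrArg y (Prod.ext h1 h2))
  · exact (min_le_right _ _).trans_eq (congrArg y (Prod.ext h2 h1))

/-- The bound holds dart by dart: an edge costs at most `2 * y d`, while the dart costs `deg * y d`
with `deg ≥ δ`. -/
lemma minDegree_mul_ufpp_le [Fintype V] (G : SimpleGraph V) [DecidableRel G.Adj] (s v : V)
    (y : V × V → ℝ) :
    (G.minDegree : ℝ≥0∞) * ufpp G (fun e => edgeMin y e.1) s v ≤
      2 * passage G s v (toWeights (scaled G y)) := by
  rw [passage, ENNReal.mul_iInf_of_ne two_ne_zero ENNReal.ofNat_ne_top]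
  refine le_iInf fun p => (mul_le_mul_right (iInf_le _ p) _).trans ?_
  have h : walkWeight (fun e : G.edgeSet => edgeMin y e.1) p.1 =
      (p.1.darts.map fun d => edgeMin y d.edge).sum := by
    have h0 : walkWeight (fun e : G.edgeSet => edgeMin y e.1) p.1 =
        (p.1.edges.attach.map (edgeMin y ∘ Subtype.val)).sum := rfl
    rw [h0, ← List.map_map, List.attach_map_subtype_val, SimpleGraph.Walk.edges, List.map_map]
    rfl
  rw [h, ← List.sum_map_mul_left]
  refine (mul_le_mul_right (ofReal_list_map_sum_le _ _) _).trans ?_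
  rw [← List.sum_map_mul_left]
  refine list_map_sum_mono _ fun d _ => ?_
  have hd : edgeMin y d.edge ≤ 2 * y (d.fst, d.snd) := edgeMin_mk_le y _ _
  simp only [toWeights, scaled, d.adj, if_true]
  rw [ENNReal.ofReal_mul (Nat.cast_nonneg _), ENNReal.ofReal_natCast, mul_left_comm]
  gcongr
  · exact G.minDegree_le_degree _
  · refine (ENNReal.ofReal_le_ofReal hd).trans_eq ?_
    rw [ENNReal.ofReal_mul zero_le_two, ENNReal.ofReal_ofNat]

/-- Distinct edges use disjoint pairs of darts, so their minima are independent, and each is Exp(1)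
by `map_two_mul_min_expMeasure`. -/
lemma map_edgeMin_eq_infinitePi [Fintype V] (G : SimpleGraph V) :
    (Measure.pi fun _ : V × V => expMeasure 1).map (fun y (e : G.edgeSet) => edgeMin y e.1) =
      Measure.infinitePi fun _ : G.edgeSet => expMeasure 1 := by
  let φ : G.edgeSet × Bool → V × V := fun i => if i.2 then Quot.out i.1.1 else (Quot.out i.1.1).swap
  have hout : ∀ e : Sym2 V, s((Quot.out e).1, (Quot.out e).2) = e := fun e => Quot.out_eq e
  have hne : ∀ e : G.edgeSet, (Quot.out e.1).1 ≠ (Quot.out e.1).2 := fun e h => by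
    have he := e.2
    rw [← hout e.1] at he
    exact (G.mem_edgeSet.mp he).ne h
  have hφ : ∀ i, s((φ i).1, (φ i).2) = i.1.1 := by
    rintro ⟨e, b⟩
    cases b
    · simp only [φ, Bool.false_eq_true, if_false, Prod.fst_swap, Prod.snd_swap]
      rw [Sym2.eq_swap, hout]
    · simp only [φ, if_true, hout]
  have hinj : Function.Injective φ := by
    rintro ⟨e, b⟩ ⟨e', b'⟩ h
    obtain rfl : e = e' := Subtype.ext (by rw [← hφ (e, b), ← hφ (e', b'), h])
    have h' := congrArg Prod.fst h
    cases b <;> cases b'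
    · rfl
    · exact absurd h'.symm (hne e)
    · exact absurd h' (hne e)
    · rfl
  have h2 : ∀ e : G.edgeSet, Measurable fun z : Bool → ℝ => 2 * min (z true) (z false) :=
    fun _ => by fun_prop
  have hcomp : (fun y (e : G.edgeSet) => edgeMin y e.1) =
      (fun (z : G.edgeSet → Bool → ℝ) e => 2 * min (z e true) (z e false)) ∘
        (MeasurableEquiv.curry G.edgeSet Bool ℝ) ∘ fun (y : V × V → ℝ) i => y (φ i) := by
    ext y e
    simp [edgeMin, φ]
  rw [hcomp, ← Measure.infinitePi_eq_pi, ← Measure.map_map (by fun_prop) (by fun_prop),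
    ← Measure.map_map (by fun_prop) (by fun_prop),
    Measure.map_infinitePi_infinitePi_of_inj hinj,
    Measure.infinitePi_map_curry fun (_ : G.edgeSet) (_ : Bool) => expMeasure 1,
    Measure.infinitePi_map_pi _ h2]
  simp_rw [Measure.infinitePi_eq_pi, map_two_mul_min_expMeasure]

lemma minDegree_mul_lintegral_ufpp_le [Fintype V] (G : SimpleGraph V) [DecidableRel G.Adj]
    (s v : V) {Ω : Type*} [MeasurableSpace Ω] (P : Measure Ω) [IsProbabilityMeasure P]
    (w : G.edgeSet → Ω → ℝ) (hw : IsExpWeights P G w) :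
    (G.minDegree : ℝ≥0∞) * ∫⁻ ω, ufpp G (fun e => w e ω) s v ∂P ≤
      2 * ∫⁻ y, passage G s v (toWeights (scaled G y))
        ∂(Measure.pi fun _ : V × V => expMeasure 1) := by
  have hlaw : P.map (fun ω e => w e ω) = Measure.infinitePi fun _ : G.edgeSet => expMeasure 1 := by
    rw [hw.indep.map_fun_eq_infinitePi_map₀' fun e => (hw.hasLaw e).aemeasurable]
    simp_rw [(hw.hasLaw _).map_eq]
  have hm : Measurable fun (y : V × V → ℝ) (e : G.edgeSet) => edgeMin y e.1 :=
    measurable_pi_lambda _ fun e => by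
      simp only [edgeMin]
      fun_prop
  rw [← lintegral_map' (measurable_ufpp G s v).aemeasurable
      (aemeasurable_pi_lambda _ fun e => (hw.hasLaw e).aemeasurable), hlaw,
    ← map_edgeMin_eq_infinitePi, lintegral_map (measurable_ufpp G s v) hm,
    ← lintegral_const_mul' _ _ (ENNReal.natCast_ne_top _),
    ← lintegral_const_mul' _ _ ENNReal.ofNat_ne_top]
  exact lintegral_mono fun y => minDegree_mul_ufpp_le G s v y

lemma ufpp_self (G : SimpleGraph V) (w : G.edgeSet → ℝ) (s : V) : ufpp G w s s = 0 :=
  nonpos_iff_eq_zero.mp ((iInf_le _ ⟨.nil, .nil⟩).trans (by simp [walkWeight]))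

end PushPercolation

end

theorem mainTheorem6 {V : Type*} [Fintype V] [MeasurableSpace V] [DiscreteMeasurableSpace V]
    (G : SimpleGraph V) [DecidableRel G.Adj] (hG : G.Connected) (s v : V)
    {Ω : Type*} [MeasurableSpace Ω] (P : Measure Ω) [IsProbabilityMeasure P]
    (w : G.edgeSet → Ω → ℝ) (hw : PushPercolation.IsExpWeights P G w)
    {Ω' : Type*} [MeasurableSpace Ω'] (P' : Measure Ω') [IsProbabilityMeasure P']
    (c : ℕ → V → Ω' → V) (hc : PushPercolation.IsPushChoices P' G c) :
    ∫⁻ ω, PushPercolation.ufpp G (fun e => w e ω) s v ∂P ≤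
      2 / (G.minDegree : ℝ≥0∞) *
        ∫⁻ ω, (PushPercolation.pushTime (fun t u => c t u ω) s v : ℝ≥0∞) ∂P' := by
  open PushPercolation in
  -- For `s = v` the left side is `0`, which covers the one-vertex graph; otherwise connectedness
  -- makes all degrees positive.
  rcases eq_or_ne s v with rfl | hsv
  · simp [ufpp_self]
  have : Nontrivial V := ⟨s, v, hsv⟩
  have hdeg : ∀ u, G.degree u ≠ 0 := fun u => (hG.preconnected.degree_pos_of_nontrivial u).ne'
  have hmin : G.minDegree ≠ 0 := by
    obtain ⟨u, hu⟩ := G.exists_minimal_degree_vertex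
    rw [hu]
    exact hdeg u
  have hne : ∀ u, (G.neighborSet u).Nonempty := fun u =>
    (G.degree_pos_iff_exists_adj u).mp (Nat.pos_of_ne_zero (hdeg u))
  have hlaw := fun t u => hc.hasLaw t u (hne u)
  -- The choices are only almost everywhere measurable; there are countably many, so measurable
  -- versions agree with all of them simultaneously almost surely.
  let c' : ℕ → V → Ω' → V := fun t u => (hlaw t u).aemeasurable.mk
  have hm : ∀ t u, Measurable (c' t u) := fun t u => (hlaw t u).aemeasurable.measurable_mk
  have hae : ∀ t u, c t u =ᵐ[P'] c' t u := fun t u => (hlaw t u).aemeasurable.ae_eq_mk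
  have hlaw' : ∀ t u, P'.map (c' t u) = uniformOn (G.neighborSet u) := fun t u => by
    rw [← Measure.map_congr (hae t u), (hlaw t u).map_eq]
  have hindep : iIndepFun (fun i : ℕ × V => c' i.1 i.2) P' :=
    hc.indep.congr fun i => hae i.1 i.2
  have hpush : ∫⁻ ω, (pushTime (fun t u => c t u ω) s v : ℝ≥0∞) ∂P' =
      ∫⁻ ω, (pushTime (fun t u => c' t u ω) s v : ℝ≥0∞) ∂P' := by
    refine lintegral_congr_ae ?_
    filter_upwards [ae_all_iff.mpr fun t => ae_all_iff.mpr fun u => hae t u] with ω hω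
    simp_rw [hω]
  obtain ⟨p⟩ := hG.preconnected s v
  have hν : ∀ u a, ¬ G.Adj u a → uniformOn (G.neighborSet u) {a} = 0 := fun u a h => by
    rw [uniformOn_eq_zero_iff (Set.toFinite _), Set.inter_singleton_eq_empty]
    exact h
  have h := (minDegree_mul_lintegral_ufpp_le G s v P w hw).trans (mul_le_mul_right
    ((lintegral_passage_scaled_le G hdeg p P' c' hm hlaw' hindep).trans
      (lintegral_passage_waitingTime_le G s v P' c' hm _ hlaw' hν hindep)) 2)
  rw [hpush, ENNReal.div_eq_inv_mul, mul_assoc, ← ENNReal.div_eq_inv_mul,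
    ENNReal.le_div_iff_mul_le (Or.inl (by exact_mod_cast hmin))
      (Or.inl (ENNReal.natCast_ne_top _)), mul_comm]
  exact h
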